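/- Let $(X,d)$ be a nonempty compact metric space and let $c:X\times X\to\mathbb R$ be continuous. For $f:X\to\mathbb R$ put $$T^-f(x)=\inf_{y\in X}\bigl(f(y)+c(y,x)\bigr)\in[-\infty,+\infty),\qquad x\in X,$$ and let $c[0]\in\mathbb R$ be the critical value, i.e. the unique real constant $C$ for which the equation $u=T^-u+C$ has a solution $u:X\to\mathbb R$. A Mather measure is a Borel probability measure $\mu$ on $X\times X$ whose two marginals are equal, $\pi_{1*}\mu=\pi_{2*}\mu$, and such that $\int_{X\times X}c\,\mathrm d\mu=-c[0]$. Let $\alpha:X\to\mathbb R$ be a continuous function such that * ($\alpha1$) $\alpha$ takes values in $[0,1)$; * ($\alpha2$) $\int_X\alpha\,\mathrm d\pi_{1*}\mu>0$ for every Mather measure $\mu$. For $\lambda\in(0,1)$, a function $u:X\to\mathbb R$ is called a $\lambda$-discounted subsolution if $u\le T^-\bigl((1-\lambda\alpha)u\bigr)+c[0]$ on $X$, and a $\lambda$-discounted solution if $u=T^-\bigl((1-\lambda\alpha)u\bigr)+c[0]$ on $X$. Then, for every $\lambda\in(0,1)$: 1. (strong comparison principle) if $u:X\to\mathbb R$ is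 a $\lambda$-discounted subsolution and $v:X\to\mathbb R$ is a $\lambda$-discounted solution, then $u\le v$ on $X$; 2. there exists exactly one $\lambda$-discounted solution. -/

import Mathlib

open MeasureTheory

noncomputable section

namespace DiscreteWeakKAM

variable {X : Type*}

/-- The (negative) Lax--Oleinik operator `T⁻ f (x) = inf_y (f y + c (y, x))`, on arbitrary real
functions `f`. It takes values in the extended reals, since the infimum is `-∞` when `f` is not
bounded below. -/
def laxOleinik (c : X × X → ℝ) (f : X → ℝ) (x : X) : EReal :=
  ⨅ y : X, ((f y + c (y, x) : ℝ) : EReal)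

/-- `u = T⁻ u + C`. -/
def IsWeakKAMSolution (c : X × X → ℝ) (C : ℝ) (u : X → ℝ) : Prop :=
  ∀ x, (u x : EReal) = laxOleinik c u x + (C : EReal)

/-- The critical value `c[0]`: the constant `C` for which `u = T⁻ u + C` has a solution
`u : X → ℝ`. (On a nonempty compact metric space with continuous cost there is exactly one
such constant.) -/
def criticalValue (c : X × X → ℝ) : ℝ :=
  Classical.epsilon fun C : ℝ => ∃ u : X → ℝ, IsWeakKAMSolution c C u

/-- A Borel probability measure on `X × X` is closed if its two marginals are equal. -/
def IsClosedProbability [MeasurableSpace X] (μ : Measure (X × X)) : Prop :=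
  IsProbabilityMeasure μ ∧ μ.map Prod.fst = μ.map Prod.snd

/-- Minimizing Mather measures: closed probability measures with `∫ c dμ = -c[0]`. -/
def IsMatherMeasure [MeasurableSpace X] (c : X × X → ℝ) (μ : Measure (X × X)) : Prop :=
  IsClosedProbability μ ∧ ∫ p, c p ∂μ = -criticalValue c

/-- The operator `u ↦ T⁻ ((1 - l α) u) + c[0]`. -/
def discountedOp (c : X × X → ℝ) (α : X → ℝ) (l : ℝ) (u : X → ℝ) (x : X) : EReal :=
  laxOleinik c (fun y => (1 - l * α y) * u y) x + (criticalValue c : EReal)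

/-- `l`-discounted subsolutions. -/
def IsDiscountedSubsolution (c : X × X → ℝ) (α : X → ℝ) (l : ℝ) (u : X → ℝ) : Prop :=
  ∀ x, (u x : EReal) ≤ discountedOp c α l u x

/-- `l`-discounted solutions. -/
def IsDiscountedSolution (c : X × X → ℝ) (α : X → ℝ) (l : ℝ) (v : X → ℝ) : Prop :=
  ∀ x, (v x : EReal) = discountedOp c α l v x

end DiscreteWeakKAM

end

open Filter Topology

namespace DiscreteWeakKAM

/-! Follow minimisers backward from x in the equation for a solution v. The calibrated chain z_n
gives u x - v x ≤ Q n * (u (z n) - v (z n)), where Q n is the product of the discount factors. If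
the sum of α along the chain were finite, the empirical measures of its steps would accumulate at a
Mather measure not charged by α, contradicting (α2). Hence Q n → 0, and since u - v is bounded
above, u ≤ v (`tendsto_sum_atTop_of_calibrated`). Uniqueness follows. Existence is Perron's method
(`exists_isWeightedSolution`) between shifts of a critical solution, itself a limit of solutions
with vanishing constant discount. -/

/-- `v` is a fixed point of `u ↦ T⁻ (a u) + C`, as an identity between real numbers. -/
def IsWeightedSolution {X : Type*} (c : X × X → ℝ) (a : X → ℝ) (C : ℝ) (v : X → ℝ) : Prop :=
  ∀ x, IsGLB (Set.range fun y => a y * v y + c (y, x) + C) (v x)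

/-- `u ≤ T⁻ (a u) + C`, as a family of inequalities between real numbers. -/
def IsWeightedSubsolution {X : Type*} (c : X × X → ℝ) (a : X → ℝ) (C : ℝ) (u : X → ℝ) : Prop :=
  ∀ x y, u x ≤ a y * u y + c (y, x) + C

/-! ### Real-valued reformulation and Perron's method -/

section General

variable {X : Type*} {c : X × X → ℝ} {a : X → ℝ} {C : ℝ} {u v : X → ℝ}

theorem le_laxOleinik_add_iff (f : X → ℝ) (x : X) (t : ℝ) :
    (t : EReal) ≤ laxOleinik c f x + (C : EReal) ↔ ∀ y, t ≤ f y + c (y, x) + C := by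
  rw [← EReal.sub_le_iff_le_add (by simp) (by simp), laxOleinik, le_iInf_iff]
  refine forall_congr' fun y => ?_
  rw [← EReal.coe_sub, EReal.coe_le_coe_iff, sub_le_iff_le_add]

theorem eq_laxOleinik_add_iff (f : X → ℝ) (x : X) (t : ℝ) :
    (t : EReal) = laxOleinik c f x + (C : EReal) ↔
      IsGLB (Set.range fun y => f y + c (y, x) + C) t := by
  constructor
  · intro h
    refine ⟨?_, fun s hs => ?_⟩
    · rintro _ ⟨y, rfl⟩
      exact (le_laxOleinik_add_iff f x t).1 h.le y
    · have := (le_laxOleinik_add_iff (c := c) (C := C) f x s).2 fun y => hs ⟨y, rfl⟩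
      rw [← h] at this
      exact_mod_cast this
  · intro h
    refine le_antisymm ((le_laxOleinik_add_iff f x t).2 fun y => h.1 ⟨y, rfl⟩) ?_
    refine EReal.le_of_forall_lt_iff_le.1 fun s hs => ?_
    have hs' : t < s := by exact_mod_cast hs
    obtain ⟨_, ⟨y, rfl⟩, hy⟩ := h.exists_between hs'
    have h1 : laxOleinik c f x ≤ ((f y + c (y, x) : ℝ) : EReal) := iInf_le _ y
    calc laxOleinik c f x + (C : EReal) ≤ ((f y + c (y, x) : ℝ) : EReal) + (C : EReal) := by gcongr
      _ = ((f y + c (y, x) + C : ℝ) : EReal) := by push_cast; rfl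
      _ ≤ (s : EReal) := by exact_mod_cast hy.2.le

theorem isWeakKAMSolution_iff :
    IsWeakKAMSolution c C u ↔ IsWeightedSolution c (fun _ => 1) C u := by
  refine forall_congr' fun x => ?_
  rw [eq_laxOleinik_add_iff]
  simp only [one_mul]

theorem isDiscountedSolution_iff {α : X → ℝ} {l : ℝ} :
    IsDiscountedSolution c α l v ↔
      IsWeightedSolution c (fun y => 1 - l * α y) (criticalValue c) v :=
  forall_congr' fun x => eq_laxOleinik_add_iff _ x _

theorem isDiscountedSubsolution_iff {α : X → ℝ} {l : ℝ} :
    IsDiscountedSubsolution c α l u ↔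
      IsWeightedSubsolution c (fun y => 1 - l * α y) (criticalValue c) u :=
  forall_congr' fun x => le_laxOleinik_add_iff _ x _

theorem IsWeightedSolution.isWeightedSubsolution (hv : IsWeightedSolution c a C v) :
    IsWeightedSubsolution c a C v := fun x y => (hv x).1 ⟨y, rfl⟩

/-- A fixed point oscillates no more than the family `x ↦ c (y, x)`. -/
theorem IsWeightedSolution.abs_sub_le (hv : IsWeightedSolution c a C v) {x x' : X} {ε : ℝ}
    (h : ∀ y, |c (y, x) - c (y, x')| ≤ ε) : |v x - v x'| ≤ ε := by
  have key : ∀ x x' : X, (∀ y, |c (y, x) - c (y, x')| ≤ ε) → v x - v x' ≤ ε := by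
    intro x x' h
    have : v x - ε ≤ v x' := by
      refine (hv x').2 ?_
      rintro _ ⟨y, rfl⟩
      have h1 := hv.isWeightedSubsolution x y
      have h2 := (abs_le.1 (h y)).2
      simp only
      linarith
    linarith
  refine abs_le.2 ⟨?_, key x x' h⟩
  have := key x' x fun y => by rw [abs_sub_comm]; exact h y
  linarith

/-- Perron's method: an ordered pair of a bounded below subsolution and a supersolution yields a
fixed point between them. -/
theorem exists_isWeightedSolution (ha : ∀ y, 0 ≤ a y) {lo hi : X → ℝ}
    (hle : ∀ x, lo x ≤ hi x) (hlo : IsWeightedSubsolution c a C lo)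
    (hhi : ∀ x, ∃ y, a y * hi y + c (y, x) + C ≤ hi x) :
    ∃ v, IsWeightedSolution c a C v ∧ ∀ x, lo x ≤ v x ∧ v x ≤ hi x := by
  let S : Set (X → ℝ) := {u | (∀ x, u x ≤ hi x) ∧ IsWeightedSubsolution c a C u}
  have hS : lo ∈ S := ⟨hle, hlo⟩
  have : Nonempty S := ⟨⟨lo, hS⟩⟩
  let w : X → ℝ := fun x => ⨆ u : S, u.1 x
  have hb : ∀ x, BddAbove (Set.range fun u : S => u.1 x) := by
    intro x
    refine ⟨hi x, ?_⟩
    rintro _ ⟨u, rfl⟩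
    exact u.2.1 x
  have hw : ∀ u ∈ S, ∀ x, u x ≤ w x := fun u hu x => le_ciSup (hb x) ⟨u, hu⟩
  have hwhi : ∀ x, w x ≤ hi x := fun x => ciSup_le fun u => u.2.1 x
  have hwsub : IsWeightedSubsolution c a C w := fun x y => ciSup_le fun u => by
    have := mul_le_mul_of_nonneg_left (hw u.1 u.2 y) (ha y)
    linarith [u.2.2 x y]
  have hSw : ∀ x, BddBelow (Set.range fun y => a y * w y + c (y, x) + C) := by
    intro x
    refine ⟨w x, ?_⟩
    rintro _ ⟨y, rfl⟩
    exact hwsub x y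
  let F : X → ℝ := fun x => ⨅ y, (a y * w y + c (y, x) + C)
  have hFle : ∀ x y, F x ≤ a y * w y + c (y, x) + C := fun x y => ciInf_le (hSw x) y
  have hwF : ∀ x, w x ≤ F x := fun x => have : Nonempty X := ⟨x⟩; le_ciInf fun y => hwsub x y
  -- Monotonicity: `w ≤ F` makes `F` a subsolution below `hi`, so maximality of `w` forces `w = F`.
  have hFS : F ∈ S := by
    refine ⟨fun x => ?_, fun x y => ?_⟩
    · obtain ⟨y, hy⟩ := hhi x
      have := mul_le_mul_of_nonneg_left (hwhi y) (ha y)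
      linarith [hFle x y]
    · have := mul_le_mul_of_nonneg_left (hwF y) (ha y)
      linarith [hFle x y]
  have hFw : ∀ x, w x = F x := fun x => le_antisymm (hwF x) (hw F hFS x)
  refine ⟨w, fun x => ?_, fun x => ⟨hw lo hS x, hwhi x⟩⟩
  have : Nonempty X := ⟨x⟩
  rw [hFw x]
  exact isGLB_ciInf (hSw x)

end General

/-! ### Compactness and the weak KAM theorem -/

section Compact

variable {X : Type*} [MetricSpace X] [CompactSpace X] {c : X × X → ℝ} {a : X → ℝ} {C : ℝ}
  {u v : X → ℝ}

theorem exists_forall_abs_le {Y : Type*} [TopologicalSpace Y] [CompactSpace Y] {f : Y → ℝ}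
    (hf : Continuous f) : ∃ K, 0 ≤ K ∧ ∀ y, |f y| ≤ K := by
  obtain ⟨K, hK⟩ := (isCompact_range hf).isBounded.exists_norm_le
  refine ⟨max K 0, le_max_right _ _, fun y => le_max_of_le_left ?_⟩
  exact hK _ ⟨y, rfl⟩

theorem exists_modulus (hc : Continuous c) {ε : ℝ} (hε : 0 < ε) :
    ∃ δ > 0, ∀ x x' : X, dist x x' < δ → ∀ y, |c (y, x) - c (y, x')| ≤ ε := by
  obtain ⟨δ, hδ, h⟩ := Metric.uniformContinuous_iff.1
    (CompactSpace.uniformContinuous_of_continuous hc) ε hε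
  refine ⟨δ, hδ, fun x x' hx y => ?_⟩
  have := h (a := (y, x)) (b := (y, x')) (by simpa [Prod.dist_eq, hδ] using hx)
  rw [Real.dist_eq] at this
  exact this.le

theorem IsWeightedSolution.continuous (hc : Continuous c) (hv : IsWeightedSolution c a C v) :
    Continuous v := by
  rw [Metric.continuous_iff]
  intro x ε hε
  obtain ⟨δ, hδ, h⟩ := exists_modulus hc (half_pos hε)
  refine ⟨δ, hδ, fun x' hx => ?_⟩
  rw [Real.dist_eq]
  exact (hv.abs_sub_le (h _ _ hx)).trans_lt (half_lt_self hε)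

/-- Solutions inherit continuity from `c`, so the infimum is attained; iterating the minimiser gives
calibrated chains. -/
theorem IsWeightedSolution.exists_eq (hc : Continuous c) (ha : Continuous a)
    (hv : IsWeightedSolution c a C v) (x : X) : ∃ y, v x = a y * v y + c (y, x) + C := by
  have : Nonempty X := ⟨x⟩
  have hcont : Continuous fun y => a y * v y + c (y, x) + C := by
    have := hv.continuous hc
    fun_prop
  have hmem := (isCompact_range hcont).isClosed.isGLB_mem (hv x) (Set.range_nonempty _)
  obtain ⟨y, hy⟩ := hmem
  exact ⟨y, hy.symm⟩

/-- Real sequences taking values in a bounded interval converge along every ultrafilter. -/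
theorem exists_tendsto_of_abs_le {ι : Type*} (U : Ultrafilter ι) {f : ι → ℝ} {K : ℝ}
    (h : ∀ i, |f i| ≤ K) : ∃ t, Tendsto f U (𝓝 t) := by
  obtain ⟨t, -, ht⟩ := (isCompact_Icc (a := -K) (b := K)).ultrafilter_le_nhds (U.map f) (by
    rw [le_principal_iff]
    exact Filter.mem_map.2 (Filter.univ_mem' fun i => abs_le.1 (h i)))
  exact ⟨t, ht⟩

/-- The weak KAM theorem: `u = T⁻ u + C` has a solution for some `C`. -/
theorem exists_isWeakKAMSolution [Nonempty X] (hc : Continuous c) :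
    ∃ (C : ℝ) (u : X → ℝ), IsWeakKAMSolution c C u := by
  obtain ⟨K, hK0, hK⟩ := exists_forall_abs_le hc
  let r : ℕ → ℝ := fun n => 1 / ((n : ℝ) + 1)
  have hr0 : ∀ n, 0 < r n := fun n => Nat.one_div_pos_of_nat
  have hr1 : ∀ n, r n ≤ 1 := fun n => by
    have : (0 : ℝ) ≤ n := n.cast_nonneg
    exact (div_le_one (by positivity)).2 (by linarith)
  have hr : Tendsto r atTop (𝓝 0) := tendsto_one_div_add_atTop_nhds_zero_nat
  -- The constants ∓K/r are a sub- and a supersolution, since r · (K/r) = K bounds |c|.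
  have hex : ∀ n, ∃ u : X → ℝ, IsWeightedSolution c (fun _ => 1 - r n) 0 u ∧
      ∀ x, -(K / r n) ≤ u x ∧ u x ≤ K / r n := by
    intro n
    have hn : r n * (K / r n) = K := mul_div_cancel₀ K (hr0 n).ne'
    have h0 : 0 ≤ K / r n := div_nonneg hK0 (hr0 n).le
    refine exists_isWeightedSolution (fun _ => by linarith [hr1 n])
      (lo := fun _ => -(K / r n)) (hi := fun _ => K / r n) (fun _ => by linarith) ?_ ?_
    · intro x y
      have := (abs_le.1 (hK (y, x))).1
      linarith
    · intro x
      refine ⟨x, ?_⟩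
      have := (abs_le.1 (hK (x, x))).2
      linarith
  choose u hu hub using hex
  obtain ⟨x0⟩ := ‹Nonempty X›
  let U : Ultrafilter ℕ := hyperfilter ℕ
  have hrU : Tendsto r U (𝓝 0) := hr.mono_left Nat.hyperfilter_le_atTop
  -- This bound does not depend on the discount, so the normalised solutions have limits.
  have hosc : ∀ n x, |u n x - u n x0| ≤ K + K := fun n x => (hu n).abs_sub_le fun y =>
    (abs_sub _ _).trans (add_le_add (hK _) (hK _))
  have hm : ∀ n, |r n * u n x0| ≤ K := by
    intro n
    rw [abs_mul, abs_of_pos (hr0 n), mul_comm, ← le_div_iff₀ (hr0 n)]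
    exact abs_le.2 (hub n x0)
  obtain ⟨m, hm⟩ := exists_tendsto_of_abs_le U hm
  choose w hw using fun x => exists_tendsto_of_abs_le U fun n => hosc n x
  have hru : ∀ y, Tendsto (fun n => r n * u n y) U (𝓝 m) := by
    intro y
    have := (hrU.mul (hw y)).add hm
    simp only [zero_mul, zero_add] at this
    exact this.congr fun n => by ring
  refine ⟨-m, w, isWeakKAMSolution_iff.2 fun x => IsLeast.isGLB ⟨?_, ?_⟩⟩
  -- Attainment survives in the limit: minimisers converge to `z`, and equicontinuity replaces `u n
  -- (y n)` by `u n z`.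
  · choose y hy using fun n => (hu n).exists_eq hc continuous_const x
    obtain ⟨z, -, hz⟩ := (isCompact_univ (X := X)).ultrafilter_le_nhds (U.map y) (by simp)
    have hz : Tendsto y U (𝓝 z) := hz
    have hdiff : Tendsto (fun n => u n (y n) - u n z) U (𝓝 0) := by
      rw [Metric.tendsto_nhds]
      intro ε hε
      obtain ⟨δ, hδ, h⟩ := exists_modulus hc (half_pos hε)
      filter_upwards [Metric.tendsto_nhds.1 hz δ hδ] with n hn
      rw [Real.dist_eq, sub_zero]
      exact ((hu n).abs_sub_le (h _ _ hn)).trans_lt (half_lt_self hε)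
    have hcz : Tendsto (fun n => c (y n, x)) U (𝓝 (c (z, x))) :=
      ((hc.comp (by fun_prop : Continuous fun y => (y, x))).tendsto z).comp hz
    have hlim := (((hw z).sub (hru z)).add hcz).add (hdiff.sub (hrU.mul hdiff))
    refine ⟨z, ?_⟩
    have := tendsto_nhds_unique hlim ((hw x).congr fun n => by
      rw [hy n]; ring)
    simp only
    linarith
  · rintro _ ⟨y, rfl⟩
    have hlim := ((hw y).sub (hru y)).add_const (c (y, x))
    have := le_of_tendsto_of_tendsto' (hw x) hlim fun n => by
      have := (hu n).isWeightedSubsolution x y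
      linarith
    simp only
    linarith

theorem exists_isWeakKAMSolution_criticalValue [Nonempty X] (hc : Continuous c) :
    ∃ u : X → ℝ, IsWeakKAMSolution c (criticalValue c) u :=
  Classical.epsilon_spec (exists_isWeakKAMSolution hc)

end Compact

/-! ### Mather measures from calibrated chains -/

/-- The empirical measures of a sequence in a compact metric space accumulate at a probability
measure whose integrals are the limits of Cesàro means, whenever these exist. -/
theorem exists_occupation_measure {E : Type*} [MetricSpace E] [CompactSpace E]
    [MeasurableSpace E] [BorelSpace E] (z : ℕ → E) :
    ∃ μ : Measure E, IsProbabilityMeasure μ ∧ ∀ f : E → ℝ, Continuous f → ∀ L : ℝ,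
      Tendsto (fun n : ℕ => ((n : ℝ) + 1)⁻¹ * ∑ k ∈ Finset.range (n + 1), f (z k)) atTop (𝓝 L) →
      ∫ p, f p ∂μ = L := by
  let ν : ℕ → Measure E := fun n =>
    ((n : ENNReal) + 1)⁻¹ • ∑ k ∈ Finset.range (n + 1), Measure.dirac (z k)
  have hν : ∀ n, IsProbabilityMeasure (ν n) := fun n => ⟨by
    simp only [ν, Measure.smul_apply, Measure.finsetSum_apply, measure_univ, smul_eq_mul,
      Finset.sum_const, Finset.card_range, nsmul_eq_mul, mul_one, Nat.cast_add, Nat.cast_one]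
    exact ENNReal.inv_mul_cancel (by simp) (by finiteness)⟩
  let U : Ultrafilter ℕ := hyperfilter ℕ
  let P : ℕ → ProbabilityMeasure E := fun n => ⟨ν n, hν n⟩
  obtain ⟨μ, -, hμ⟩ := (isCompact_univ (X := ProbabilityMeasure E)).ultrafilter_le_nhds
    (U.map P) (by simp)
  have hμ : Tendsto P U (𝓝 μ) := hμ
  refine ⟨μ, inferInstance, fun f hf L hL => ?_⟩
  have h1 := (ProbabilityMeasure.tendsto_iff_forall_integral_tendsto.1 hμ)
    (BoundedContinuousFunction.mkOfCompact ⟨f, hf⟩)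
  refine tendsto_nhds_unique h1 ((hL.mono_left Nat.hyperfilter_le_atTop).congr fun n => ?_)
  change _ = ∫ p, f p ∂(ν n)
  rw [integral_smul_measure, integral_finsetSum_measure fun k _ => ?_]
  · simp [integral_dirac, ENNReal.toReal_add]
  · exact integrable_dirac (by finiteness)

section Mather

variable {X : Type*} [MetricSpace X] [CompactSpace X] [MeasurableSpace X] [BorelSpace X]
  {c : X × X → ℝ} {C : ℝ}

theorem tendsto_cesaro_zero_of_abs_le {s : ℕ → ℝ} {K : ℝ} (h : ∀ n, |s n| ≤ K) :
    Tendsto (fun n : ℕ => ((n : ℝ) + 1)⁻¹ * s (n + 1)) atTop (𝓝 0) := by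
  have h0 : Tendsto (fun n : ℕ => ((n : ℝ) + 1)⁻¹) atTop (𝓝 0) := by
    simpa only [one_div] using tendsto_one_div_add_atTop_nhds_zero_nat (𝕜 := ℝ)
  simp_rw [mul_comm _ (s _)]
  exact bdd_le_mul_tendsto_zero' K (Eventually.of_forall fun n => h (n + 1)) h0

/-- Along a backward calibrated chain of a discounted solution the discount factors are not
summable, provided they charge every Mather measure. -/
theorem tendsto_sum_atTop_of_calibrated (hc : Continuous c) {α : X → ℝ} (hα : Continuous α)
    (hα0 : ∀ x, 0 ≤ α x)
    (hα2 : ∀ μ : Measure (X × X), IsMatherMeasure c μ → 0 < ∫ x, α x ∂(μ.map Prod.fst))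
    {l : ℝ} {v : X → ℝ} (hv : Continuous v) {x : ℕ → X}
    (hx : ∀ n, v (x n) = (1 - l * α (x (n + 1))) * v (x (n + 1)) + c (x (n + 1), x n)
      + criticalValue c) :
    Tendsto (fun n => ∑ k ∈ Finset.range n, α (x (k + 1))) atTop atTop := by
  have hmono : Monotone fun n => ∑ k ∈ Finset.range n, α (x (k + 1)) :=
    monotone_nat_of_le_succ fun n => by
      rw [Finset.sum_range_succ]
      linarith [hα0 (x (n + 1))]
  by_contra hnot
  obtain ⟨A, hA⟩ := (tendsto_atTop_of_monotone hmono).resolve_left hnot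
  have hA' : ∀ n, |∑ k ∈ Finset.range n, α (x (k + 1))| ≤ A := fun n => by
    rw [abs_of_nonneg (Finset.sum_nonneg fun k _ => hα0 _)]
    exact hmono.ge_of_tendsto hA n
  obtain ⟨B, hB0, hB⟩ := exists_forall_abs_le hv
  obtain ⟨μ, hμ, hint⟩ := exists_occupation_measure fun k => (x (k + 1), x k)
  -- Telescoping sums stay bounded, so their averages vanish; this yields equal marginals.
  have htel : ∀ g : X → ℝ, Continuous g → ∫ p, g p.1 - g p.2 ∂μ = 0 := by
    intro g hg
    obtain ⟨G, -, hG⟩ := exists_forall_abs_le hg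
    refine hint (fun p => g p.1 - g p.2) (by fun_prop) 0 ?_
    refine tendsto_cesaro_zero_of_abs_le (K := G + G)
      (s := fun n => ∑ k ∈ Finset.range n, (g (x (k + 1)) - g (x k))) fun n => ?_
    rw [Finset.sum_range_sub fun k => g (x k)]
    exact (abs_sub _ _).trans (add_le_add (hG _) (hG _))
  have hαint : ∫ p, α p.1 ∂μ = 0 :=
    hint (fun p => α p.1) (by fun_prop) 0 (tendsto_cesaro_zero_of_abs_le hA')
  have hcint : ∫ p, c p ∂μ = -criticalValue c := by
    refine hint c hc _ ?_
    have hb : ∀ n, |∑ k ∈ Finset.range n, (c (x (k + 1), x k) + criticalValue c)| ≤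
        (B + B) + |l| * B * A := by
      intro n
      -- Calibration splits the cost into a telescoping part and a discount part, the latter
      -- controlled by the bounded sum of α.
      have : ∑ k ∈ Finset.range n, (c (x (k + 1), x k) + criticalValue c) =
          (v (x 0) - v (x n)) + ∑ k ∈ Finset.range n, l * v (x (k + 1)) * α (x (k + 1)) := by
        rw [← Finset.sum_range_sub' (fun k => v (x k)), ← Finset.sum_add_distrib]
        refine Finset.sum_congr rfl fun k _ => ?_
        linarith [hx k]
      rw [this]
      refine (abs_add_le _ _).trans (add_le_add
        ((abs_sub _ _).trans (add_le_add (hB _) (hB _))) ?_)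
      calc |∑ k ∈ Finset.range n, l * v (x (k + 1)) * α (x (k + 1))|
          ≤ ∑ k ∈ Finset.range n, |l * v (x (k + 1)) * α (x (k + 1))| :=
            Finset.abs_sum_le_sum_abs _ _
        _ ≤ ∑ k ∈ Finset.range n, |l| * B * α (x (k + 1)) := by
            refine Finset.sum_le_sum fun k _ => ?_
            rw [abs_mul, abs_mul, abs_of_nonneg (hα0 _)]
            gcongr
            · exact hα0 _
            · exact hB _
        _ ≤ |l| * B * A := by
            rw [← Finset.mul_sum]
            gcongr
            exact (le_abs_self _).trans (hA' n)
    have := (tendsto_cesaro_zero_of_abs_le hb).add_const (-criticalValue c)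
    rw [zero_add] at this
    refine this.congr fun n => ?_
    have hn : (n : ℝ) + 1 ≠ 0 := by positivity
    rw [Finset.sum_add_distrib, Finset.sum_const, Finset.card_range, nsmul_eq_mul]
    push_cast
    field_simp
    ring
  have hmarg : μ.map Prod.fst = μ.map Prod.snd := by
    have : IsProbabilityMeasure (μ.map Prod.fst) :=
      Measure.isProbabilityMeasure_map measurable_fst.aemeasurable
    have : IsProbabilityMeasure (μ.map Prod.snd) :=
      Measure.isProbabilityMeasure_map measurable_snd.aemeasurable
    refine ext_of_forall_integral_eq_of_IsFiniteMeasure fun g => ?_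
    rw [integral_map measurable_fst.aemeasurable g.continuous.aestronglyMeasurable,
      integral_map measurable_snd.aemeasurable g.continuous.aestronglyMeasurable]
    have h := htel g g.continuous
    have hi : ∀ f : X × X → ℝ, Continuous f → Integrable f μ := fun f hf =>
      (BoundedContinuousFunction.mkOfCompact ⟨f, hf⟩).integrable μ
    rw [integral_sub (hi _ (by fun_prop)) (hi _ (by fun_prop))] at h
    linarith
  have := hα2 μ ⟨⟨hμ, hmarg⟩, hcint⟩
  rw [integral_map measurable_fst.aemeasurable hα.aestronglyMeasurable, hαint] at this
  exact lt_irrefl 0 this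

end Mather

end DiscreteWeakKAM

/-! ### Comparison, existence and uniqueness -/

open DiscreteWeakKAM in
theorem mainTheorem3 {X : Type*} [MetricSpace X] [CompactSpace X] [Nonempty X]
    [MeasurableSpace X] [BorelSpace X]
    (c : X × X → ℝ) (hc : Continuous c)
    (α : X → ℝ) (hα : Continuous α)
    (hα1 : ∀ x, 0 ≤ α x ∧ α x < 1)
    (hα2 : ∀ μ : MeasureTheory.Measure (X × X), DiscreteWeakKAM.IsMatherMeasure c μ →
      0 < ∫ x, α x ∂(μ.map Prod.fst))
    (l : ℝ) (hl0 : 0 < l) (hl1 : l < 1) :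
    (∀ u v : X → ℝ, DiscreteWeakKAM.IsDiscountedSubsolution c α l u →
      DiscreteWeakKAM.IsDiscountedSolution c α l v → ∀ x, u x ≤ v x) ∧
    ∃! v : X → ℝ, DiscreteWeakKAM.IsDiscountedSolution c α l v := by
  have hapos : ∀ y, 0 ≤ 1 - l * α y := fun y => by
    nlinarith [hα1 y]
  have hacont : Continuous fun y => 1 - l * α y := by fun_prop
  have comparison : ∀ u v : X → ℝ, IsDiscountedSubsolution c α l u →
      IsDiscountedSolution c α l v → ∀ x, u x ≤ v x := by
    intro u v hu hv x
    rw [isDiscountedSubsolution_iff] at hu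
    rw [isDiscountedSolution_iff] at hv
    have hvc := hv.continuous hc
    choose pre hpre using hv.exists_eq hc hacont
    let z : ℕ → X := fun n => pre^[n] x
    have hz : ∀ n, z (n + 1) = pre (z n) := fun n => Function.iterate_succ_apply' pre n x
    have hcal : ∀ n, v (z n) = (1 - l * α (z (n + 1))) * v (z (n + 1)) + c (z (n + 1), z n)
        + criticalValue c := fun n => by rw [hz]; exact hpre (z n)
    have hsum := tendsto_sum_atTop_of_calibrated hc hα (fun y => (hα1 y).1) hα2 hvc hcal
    let Q : ℕ → ℝ := fun n => ∏ k ∈ Finset.range n, (1 - l * α (z (k + 1)))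
    have hQ0 : ∀ n, 0 ≤ Q n := fun n => Finset.prod_nonneg fun k _ => hapos _
    have hstep : ∀ n, u x - v x ≤ Q n * (u (z n) - v (z n)) := by
      intro n
      induction n with
      | zero => simp [Q, z]
      | succ n ih =>
        refine ih.trans ?_
        have h1 : u (z n) - v (z n) ≤
            (1 - l * α (z (n + 1))) * (u (z (n + 1)) - v (z (n + 1))) := by
          linarith [hu (z n) (z (n + 1)), hcal n]
        calc Q n * (u (z n) - v (z n)) ≤ Q n * _ := mul_le_mul_of_nonneg_left h1 (hQ0 n)
          _ = Q (n + 1) * (u (z (n + 1)) - v (z (n + 1))) := by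
            simp only [Q, Finset.prod_range_succ]; ring
    have hQle : ∀ n, Q n ≤ Real.exp (-(l * ∑ k ∈ Finset.range n, α (z (k + 1)))) := by
      intro n
      rw [Finset.mul_sum, ← Finset.sum_neg_distrib, Real.exp_sum]
      exact Finset.prod_le_prod (fun k _ => hapos _) fun k _ => Real.one_sub_le_exp_neg _
    have hQlim : Tendsto Q atTop (𝓝 0) :=
      squeeze_zero hQ0 hQle (Real.tendsto_exp_neg_atTop_nhds_zero.comp (hsum.const_mul_atTop hl0))
    obtain ⟨B, hB0, hB⟩ := exists_forall_abs_le hvc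
    obtain ⟨K, hK0, hK⟩ := exists_forall_abs_le hc
    obtain ⟨A, hA0, hA⟩ := exists_forall_abs_le hacont
    -- No regularity of `u` is assumed: the subsolution inequality with `x` as source point bounds
    -- `u` above.
    have hub : ∀ y, u y - v y ≤ A * |u x| + K + |criticalValue c| + B := by
      intro y
      have h1 := hu y x
      have h2 : (1 - l * α x) * u x ≤ A * |u x| := by
        refine (le_abs_self _).trans ?_
        rw [abs_mul]
        exact mul_le_mul_of_nonneg_right (hA x) (abs_nonneg _)
      linarith [(abs_le.1 (hK (x, y))).2, (abs_le.1 (hB y)).1, le_abs_self (criticalValue c)]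
    have hlim := hQlim.mul_const (A * |u x| + K + |criticalValue c| + B)
    rw [zero_mul] at hlim
    have := ge_of_tendsto' hlim fun n =>
      (hstep n).trans (mul_le_mul_of_nonneg_left (hub (z n)) (hQ0 n))
    linarith
  refine ⟨comparison, ?_⟩
  obtain ⟨w, hw⟩ := exists_isWeakKAMSolution_criticalValue hc
  rw [isWeakKAMSolution_iff] at hw
  obtain ⟨B, hB0, hB⟩ := exists_forall_abs_le (hw.continuous hc)
  -- Since w - B ≤ 0 ≤ w + B, discounting raises the lower barrier and lowers the upper one, so the
  -- critical equation for w gives both inequalities.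
  obtain ⟨v, hv, -⟩ := exists_isWeightedSolution (c := c) (C := criticalValue c) hapos
    (lo := fun x => w x - B) (hi := fun x => w x + B) (fun x => by linarith)
    (fun x y => by
      have h1 := hw.isWeightedSubsolution x y
      have h2 : 0 ≤ l * α y * (B - w y) := mul_nonneg (mul_nonneg hl0.le (hα1 y).1)
        (by linarith [(abs_le.1 (hB y)).2])
      linarith)
    (fun x => by
      obtain ⟨y, hy⟩ := hw.exists_eq hc continuous_const x
      have h2 : 0 ≤ l * α y * (w y + B) := mul_nonneg (mul_nonneg hl0.le (hα1 y).1)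
        (by linarith [(abs_le.1 (hB y)).1])
      exact ⟨y, by linarith⟩)
  rw [← isDiscountedSolution_iff] at hv
  refine ⟨v, hv, fun v' hv' => funext fun x => le_antisymm ?_ ?_⟩
  · exact comparison v' v (fun x => (hv' x).le) hv x
  · exact comparison v v' (fun x => (hv x).le) hv' x
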